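/- Let $n\ge 1$, let $\Delta^{n+1}=\{\lambda\in\mathbb R^{n+1}_{\ge 0}:\sum_{j=1}^{n+1}\lambda_j=1\}$, and let the SOS2 constraint with $n$ segments be the family $\mathcal P=(P^i)_{i=1}^n$ with $P^i=\{\lambda\in\Delta^{n+1}:\lambda_j\le 0\ \text{for all } j\notin\{i,i+1\}\}$. For $k\ge\lceil\log_2 n\rceil$ let $\mathcal H_k(n)$ be the set of encodings, that is, of families $H=(h^i)_{i=1}^n$ of pairwise distinct vectors $h^i\in\{0,1\}^k$, and put $Q(\mathcal P,H)=\operatorname{conv}\bigl(\bigcup_{i=1}^n P^i\times\{h^i\}\bigr)\subseteq\mathbb R^{n+1}\times\mathbb R^k$ (the LP relaxation of the embedding formulation of $\mathcal P$ with encoding $H$). For a polyhedron $Q$ let $\operatorname{size}(Q)$ be the minimum number of linear inequalities needed to describe $Q$, where an equation counts as two inequalities, and let the embedding complexity be $$\operatorname{mmc}(\mathcal P)=\min\Bigl\{\operatorname{size}(Q(\mathcal P,H)) : H\in\bigcup_{k\ge\lceil\log_2 n\rceil}\mathcal H_k(n)\Bigr\}.$$ For an encoding $H$ let $L(H)=\operatorname{aff}(H)-h^1$,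 $c^i=h^{i+1}-h^i$ for $1\le i\le n-1$, $h^0=h^1$ and $h^{n+1}=h^n$. The general inequalities of $Q(\mathcal P,H)$ are $$\sum_{j=1}^{n+1}\min\{b\cdot h^j,b\cdot h^{j-1}\}\lambda_j\ \le\ b\cdot y\ \le\ \sum_{j=1}^{n+1}\max\{b\cdot h^j,b\cdot h^{j-1}\}\lambda_j ,$$ two for each linear hyperplane $M(b)=\{y\in L(H): b\cdot y=0\}$, $b\in L(H)\setminus\{0\}$, of $L(H)$ that is spanned by a subset of $\{c^1,\dots,c^{n-1}\}$ (inequalities that are positive multiples of one another are identified). Let $\operatorname{size}_G(Q(\mathcal P,H))$ be their number, and let $\operatorname{mmc}_G(\mathcal P)$ be the minimum of $\operatorname{size}_G(Q(\mathcal P,H))$ over all $H\in\bigcup_{k\ge\lceil\log_2 n\rceil}\mathcal H_k(n)$. Then: 1. $\operatorname{mmc}_G(\mathcal P)=2\lceil\log_2 n\rceil$. The minimum over the same encodings $H$ of the number of facets of $Q(\mathcal P,H)$ that are not defined by a bound on one of the variables $\lambda_j$ has the same value $2\lceil\log_2 n\rceil$. 2. $n+3+\lceil\log_2 n\rceil\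 \le\ \operatorname{mmc}(\mathcal P)\ \le\ n+3+2\lceil\log_2 n\rceil$. -/

import Mathlib

namespace EmbeddingFormulation

section Polyhedra

variable {E : Type*} [AddCommGroup E] [Module ℝ E]

/-- `Q` is the solution set of a system of `p` linear inequalities and `q` linear equations. -/
def HasDescription (Q : Set E) (p q : ℕ) : Prop :=
  ∃ (a : Fin p → Module.Dual ℝ E) (α : Fin p → ℝ) (c : Fin q → Module.Dual ℝ E) (γ : Fin q → ℝ),
    Q = {x | (∀ i, a i x ≤ α i) ∧ ∀ j, c j x = γ j}

/-- The minimum number of inequalities needed to describe `Q`, an equation being counted as two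
inequalities (the value is `⊤` if `Q` is not a polyhedron). -/
noncomputable def size (Q : Set E) : ℕ∞ :=
  ⨅ (p : ℕ) (q : ℕ) (_ : HasDescription Q p q), ((p + 2 * q : ℕ) : ℕ∞)

/-- `F` is a facet of `Q`: a nonempty face of `Q` whose dimension is one less than that of `Q`. -/
def IsFacet (Q F : Set E) : Prop :=
  F.Nonempty ∧
  (∃ (φ : Module.Dual ℝ E) (t : ℝ), (∀ x ∈ Q, φ x ≤ t) ∧ F = {x ∈ Q | φ x = t}) ∧
  Module.finrank ℝ (vectorSpan ℝ F) + 1 = Module.finrank ℝ (vectorSpan ℝ Q)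

end Polyhedra

/-- Encodings: families of `n` pairwise distinct `0`-`1` vectors of length `k`. -/
def encodings (n k : ℕ) : Set (Fin n → Fin k → ℝ) :=
  {h | (∀ i l, h i l = 0 ∨ h i l = 1) ∧ Function.Injective h}

/-- The LP relaxation of the embedding formulation of the family `P` with encoding `h`. -/
def embeddingHull {d n k : ℕ} (P : Fin n → Set (Fin d → ℝ)) (h : Fin n → Fin k → ℝ) :
    Set ((Fin d → ℝ) × (Fin k → ℝ)) :=
  convexHull ℝ (⋃ i, P i ×ˢ {h i})

/-- The embedding complexity of the family `P`. -/
noncomputable def mmc {d n : ℕ} (P : Fin n → Set (Fin d → ℝ)) : ℕ∞ :=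
  ⨅ (k : ℕ) (_ : Nat.clog 2 n ≤ k) (h : Fin n → Fin k → ℝ) (_ : h ∈ encodings n k),
    size (embeddingHull P h)

/-- The SOS2 constraint with `n` segments on the standard simplex of `ℝ^(n+1)`. -/
def sos2 (n : ℕ) (i : Fin n) : Set (Fin (n + 1) → ℝ) :=
  {x | x ∈ stdSimplex ℝ (Fin (n + 1)) ∧ ∀ j, j ≠ i.castSucc → j ≠ i.succ → x j ≤ 0}

section SOS2

variable {n k : ℕ}

/-- The linear space parallel to the affine hull of the encoding. -/
def linSpace (h : Fin n → Fin k → ℝ) : Submodule ℝ (Fin k → ℝ) :=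
  (affineSpan ℝ (Set.range h)).direction

/-- The set of differences `h^{i+1} - h^i` of consecutive elements of the encoding. -/
def steps (h : Fin n → Fin k → ℝ) : Set (Fin k → ℝ) :=
  {v | ∃ i j : Fin n, (j : ℕ) = i + 1 ∧ v = h j - h i}

/-- The hyperplane `M(b) = {y ∈ L(H) | b · y = 0}` of `L(H)` defined by `b`. -/
def hyperplane (h : Fin n → Fin k → ℝ) (b : Fin k → ℝ) : Set (Fin k → ℝ) :=
  {y | y ∈ linSpace h ∧ b ⬝ᵥ y = 0}

/-- `b` is a nonzero element of `L(H)` whose hyperplane `M(b)` is spanned by consecutive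
differences of the encoding. -/
def IsSpannedNormal (h : Fin n → Fin k → ℝ) (b : Fin k → ℝ) : Prop :=
  b ∈ linSpace h ∧ b ≠ 0 ∧
    ∃ S ⊆ steps h, (Submodule.span ℝ S : Set (Fin k → ℝ)) = hyperplane h b

/-- Positions of the simplex variables are numbered `0, …, n` and encoding vectors `0, …, n - 1`.
This is the encoding vector of the segment that ends at position `j`; at position `0` it is the
first vector. -/
def before [NeZero n] (h : Fin n → Fin k → ℝ) (j : Fin (n + 1)) : Fin k → ℝ :=
  h (Fin.ofNat n ((j : ℕ) - 1))

/-- The encoding vector of the segment that starts at position `j`; at position `n` it is the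
last vector. -/
def after [NeZero n] (h : Fin n → Fin k → ℝ) (j : Fin (n + 1)) : Fin k → ℝ :=
  h (Fin.ofNat n (min (j : ℕ) (n - 1)))

/-- The general (non-bound) inequalities of the embedding formulation of the SOS2 constraint,
`∑ j, min (b · h^j) (b · h^{j-1}) λ_j ≤ b · y ≤ ∑ j, max (b · h^j) (b · h^{j-1}) λ_j`, two for each
hyperplane `M(b)` spanned by consecutive differences. An inequality is represented by the half-space
that it defines, so that positive multiples of an inequality are identified. -/
def generalInequalities [NeZero n] (h : Fin n → Fin k → ℝ) :
    Set (Set ((Fin (n + 1) → ℝ) × (Fin k → ℝ))) :=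
  {S | ∃ b, IsSpannedNormal h b ∧
    (S = {x | ∑ j, min (b ⬝ᵥ after h j) (b ⬝ᵥ before h j) * x.1 j ≤ b ⬝ᵥ x.2} ∨
     S = {x | b ⬝ᵥ x.2 ≤ ∑ j, max (b ⬝ᵥ after h j) (b ⬝ᵥ before h j) * x.1 j})}

/-- The smallest number of general inequalities over all embedding formulations of the SOS2
constraint with `n` segments. -/
noncomputable def mmcG (n : ℕ) [NeZero n] : ℕ∞ :=
  ⨅ (k : ℕ) (_ : Nat.clog 2 n ≤ k) (h : Fin n → Fin k → ℝ) (_ : h ∈ encodings n k),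
    (generalInequalities h).encard

/-- The face `F` of `Q` is defined by a bound, lower or upper, on one of the variables `λ_j`. -/
def IsBoundFace {d : ℕ} (Q F : Set ((Fin d → ℝ) × (Fin k → ℝ))) : Prop :=
  ∃ (j : Fin d) (t : ℝ),
    ((∀ x ∈ Q, t ≤ x.1 j) ∨ (∀ x ∈ Q, x.1 j ≤ t)) ∧ F = {x ∈ Q | x.1 j = t}

/-- The facets of the LP relaxation that are not defined by a bound on one of the variables
`λ_j`. -/
def generalFacets (h : Fin n → Fin k → ℝ) : Set (Set ((Fin (n + 1) → ℝ) × (Fin k → ℝ))) :=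
  {F | IsFacet (embeddingHull (sos2 n) h) F ∧ ¬ IsBoundFace (embeddingHull (sos2 n) h) F}

/-- The smallest number of non-bound facets over all embedding formulations of the SOS2
constraint with `n` segments. -/
noncomputable def mmcGFacets (n : ℕ) : ℕ∞ :=
  ⨅ (k : ℕ) (_ : Nat.clog 2 n ≤ k) (h : Fin n → Fin k → ℝ) (_ : h ∈ encodings n k),
    (generalFacets h).encard

end SOS2

end EmbeddingFormulation

namespace EmbeddingFormulation

/-! ### Sizes and facets of general polyhedra -/

section Polyhedra

variable {E : Type*} [AddCommGroup E] [Module ℝ E]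

/-! Write `r` for the dimension of `L(H)`. Some `r` coordinates form a basis of the dual of `L(H)`,
so they determine each 0-1 vector of the encoding; hence `n ≤ 2 ^ r`, that is, `⌈log₂ n⌉ ≤ r`
(`clog_le_finrank_linSpace`).

Consecutive differences span `L(H)`, so `r` of them form a basis. Each vector of the dual basis is
normal to the hyperplane spanned by the other differences. With both signs this gives `2r` general
inequalities, which are distinct because their normals have different signs on the basis
(`two_mul_finrank_le_encard`). Each defines a facet (`isFacet_gapFace`), and never one given by a
bound on some `λ_j`. This proves both lower bounds in part 1.

They are attained by a Gray code of length `⌈log₂ n⌉`. There `L(H)` is the whole space and every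
difference is a multiple of a unit vector, so only coordinate hyperplanes are spanned. The resulting
`2⌈log₂ n⌉` inequalities, with `λ ≥ 0` and `∑ λ_j = 1`, describe `Q` completely
(`embeddingHull_eq_of_isGray`). This gives the upper bound on size, and no non-bound facets other
than these.

The lower bound on size uses only that `Q` is bounded, has two points and lies in a hyperplane of a
space of dimension `n + 1 + k` (`finrank_add_two_le_size`). -/

theorem hasDescription_of_fintype {ι κ : Type*} [Fintype ι] [Fintype κ] {Q : Set E}
    (a : ι → Module.Dual ℝ E) (α : ι → ℝ) (c : κ → Module.Dual ℝ E) (γ : κ → ℝ)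
    (hQ : Q = {x | (∀ i, a i x ≤ α i) ∧ ∀ j, c j x = γ j}) :
    HasDescription Q (Fintype.card ι) (Fintype.card κ) := by
  refine ⟨a ∘ (Fintype.equivFin ι).symm, α ∘ (Fintype.equivFin ι).symm,
    c ∘ (Fintype.equivFin κ).symm, γ ∘ (Fintype.equivFin κ).symm, ?_⟩
  rw [hQ]
  ext x
  simp only [Set.mem_ofPred_eq, Function.comp_apply]
  rw [(Fintype.equivFin ι).symm.forall_congr_left (p := fun i => a _ x ≤ α _),
    (Fintype.equivFin κ).symm.forall_congr_left (p := fun i => c _ x = γ _)]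
  simp

theorem HasDescription.size_le {Q : Set E} {p q : ℕ} (hQ : HasDescription Q p q) :
    size Q ≤ ((p + 2 * q : ℕ) : ℕ∞) :=
  iInf_le_of_le p (iInf_le_of_le q (iInf_le _ hQ))

-- Strict inequalities survive a small move by continuity; tight ones become strict if the move
-- decreases them.
open Filter Topology in
theorem eventually_add_smul_lt {ι : Type*} [Finite ι] {a : ι → Module.Dual ℝ E} {α : ι → ℝ}
    {x : E} (v : E) (h : ∀ i, a i x < α i ∨ (a i x ≤ α i ∧ a i v < 0)) :
    ∀ᶠ ε in 𝓝[>] (0 : ℝ), ∀ i, a i (x + ε • v) < α i := by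
  rw [eventually_all]
  intro i
  simp only [map_add, map_smul, smul_eq_mul]
  rcases h i with h | ⟨h, h'⟩
  · have : Tendsto (fun ε : ℝ => a i x + ε * a i v) (𝓝 0) (𝓝 (a i x + 0 * a i v)) :=
      Continuous.tendsto (by fun_prop) 0
    rw [zero_mul, add_zero] at this
    exact (this.eventually (gt_mem_nhds h)).filter_mono nhdsWithin_le_nhds
  · filter_upwards [self_mem_nhdsWithin] with ε hε
    have : ε * a i v < 0 := mul_neg_of_pos_of_neg hε h'
    linarith

open Filter Topology in
theorem eventually_add_smul_le {ι : Type*} [Finite ι] {a : ι → Module.Dual ℝ E} {α : ι → ℝ}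
    {x : E} (v : E) (h : ∀ i, a i x < α i ∨ (a i x ≤ α i ∧ a i v ≤ 0)) :
    ∀ᶠ ε in 𝓝[>] (0 : ℝ), ∀ i, a i (x + ε • v) ≤ α i := by
  rw [eventually_all]
  intro i
  simp only [map_add, map_smul, smul_eq_mul]
  rcases h i with h | ⟨h, h'⟩
  · have : Tendsto (fun ε : ℝ => a i x + ε * a i v) (𝓝 0) (𝓝 (a i x + 0 * a i v)) :=
      Continuous.tendsto (by fun_prop) 0
    rw [zero_mul, add_zero] at this
    exact ((this.eventually (gt_mem_nhds h)).filter_mono nhdsWithin_le_nhds).mono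
      fun _ => le_of_lt
  · filter_upwards [self_mem_nhdsWithin] with ε hε
    have : ε * a i v ≤ 0 := mul_nonpos_of_nonneg_of_nonpos (le_of_lt hε) h'
    linarith

/-- A polyhedron without rays that has two points and lies in a hyperplane is not described by
fewer than `dim + 2` inequalities. -/
theorem finrank_add_two_le_card [FiniteDimensional ℝ E] {ι : Type*} [Fintype ι] {Q : Set E}
    {a : ι → Module.Dual ℝ E} {α : ι → ℝ} (hQ : Q = {x | ∀ i, a i x ≤ α i})
    (hray : ∀ x ∈ Q, ∀ v, (∀ t : ℝ, 0 ≤ t → x + t • v ∈ Q) → v = 0)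
    (hQ2 : Q.Nontrivial) {φ : Module.Dual ℝ E} (hφ : φ ≠ 0) {s : ℝ} (hφQ : ∀ x ∈ Q, φ x = s) :
    Module.finrank ℝ E + 2 ≤ Fintype.card ι := by
  classical
  by_contra! hlt
  obtain ⟨x, hx, y, hy, hxy⟩ := hQ2
  -- The recession cone is trivial.
  have hcone : ∀ v, (∀ i, a i v ≤ 0) → v = 0 := fun v hv => by
    refine hray x hx v fun t ht => ?_
    rw [hQ] at hx ⊢
    intro i
    rw [map_add, map_smul, smul_eq_mul]
    linarith [hx i, mul_nonpos_of_nonneg_of_nonpos ht (hv i)]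
  have hyQ := hy
  rw [hQ] at hx hy
  -- An inequality that is strict at `y`. The others are already injective: a common zero, up to
  -- sign, lies in the recession cone.
  obtain ⟨i₀, hi₀⟩ : ∃ i, a i y < a i x := by
    by_contra! hle
    refine hxy (sub_eq_zero.1 (hcone (x - y) fun i => ?_))
    rw [map_sub]
    linarith [hle i]
  let A : E →ₗ[ℝ] ({i // i ≠ i₀} → ℝ) := LinearMap.pi fun i => a i
  have hinj : Function.Injective A := by
    rw [← LinearMap.ker_eq_bot, LinearMap.ker_eq_bot']
    intro v hv
    have hv' : ∀ i, i ≠ i₀ → a i v = 0 := fun i hi => congrFun hv ⟨i, hi⟩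
    rcases le_total (a i₀ v) 0 with h0 | h0
    · refine hcone v fun i => ?_
      by_cases hi : i = i₀
      · rwa [hi]
      · exact (hv' i hi).le
    · refine neg_eq_zero.1 (hcone (-v) fun i => ?_)
      rw [map_neg]
      by_cases hi : i = i₀
      · rw [hi]; linarith
      · rw [hv' i hi, neg_zero]
  have hcard : Module.finrank ℝ E = Module.finrank ℝ ({i // i ≠ i₀} → ℝ) := by
    have h1 := LinearMap.finrank_le_finrank_of_injective hinj
    have h2 : Fintype.card {i // i ≠ i₀} = Fintype.card ι - 1 := by
      simp [Fintype.card_subtype_compl]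
    rw [Module.finrank_fintype_fun_eq_card] at h1 ⊢
    omega
  have hsurj := (LinearMap.injective_iff_surjective_of_finrank_eq_finrank hcard).1 hinj
  -- If there were too few inequalities, all those other than `i₀` could be decreased at once,
  -- making `y + ε • v` an interior point. This is impossible inside the hyperplane `φ = s`.
  obtain ⟨v, hv⟩ := hsurj fun _ => -1
  have hv' : ∀ i, i ≠ i₀ → a i v = -1 := fun i hi => congrFun hv ⟨i, hi⟩
  obtain ⟨ε, hε⟩ := (eventually_add_smul_lt (a := a) (α := α) (x := y) v fun i => by
    by_cases hi : i = i₀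
    · left
      rw [hi]
      exact hi₀.trans_le (hx i₀)
    · right
      exact ⟨hy i, by rw [hv' i hi]; norm_num⟩).exists
  obtain ⟨w, hw⟩ : ∃ w, φ w ≠ 0 := by
    by_contra! h
    exact hφ (LinearMap.ext h)
  obtain ⟨δ, hδ, hδ0⟩ := ((eventually_add_smul_lt (a := a) (α := α) (x := y + ε • v) w
    fun i => Or.inl (hε i)).and self_mem_nhdsWithin).exists
  have e1 := hφQ (y + ε • v) (by rw [hQ]; exact fun i => (hε i).le)
  have e2 := hφQ (y + ε • v + δ • w) (by rw [hQ]; exact fun i => (hδ i).le)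
  rw [map_add, e1, map_smul, smul_eq_mul] at e2
  exact mul_ne_zero (ne_of_gt hδ0) hw (by linarith)

/-- Lower bound on the size of a polyhedron without rays that has two points and lies in a
hyperplane. -/
theorem finrank_add_two_le_size [FiniteDimensional ℝ E] {Q : Set E}
    (hray : ∀ x ∈ Q, ∀ v, (∀ t : ℝ, 0 ≤ t → x + t • v ∈ Q) → v = 0)
    (hQ2 : Q.Nontrivial) {φ : Module.Dual ℝ E} (hφ : φ ≠ 0) {s : ℝ} (hφQ : ∀ x ∈ Q, φ x = s) :
    ((Module.finrank ℝ E + 2 : ℕ) : ℕ∞) ≤ size Q := by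
  refine le_iInf fun p => le_iInf fun q => le_iInf fun ⟨a, α, c, γ, hQ⟩ => ?_
  rw [Nat.cast_le]
  have hQ' : Q = {x | ∀ i : Fin p ⊕ (Fin q ⊕ Fin q),
      (Sum.elim a (Sum.elim c (-c)) i) x ≤ Sum.elim α (Sum.elim γ (-γ)) i} := by
    rw [hQ]
    ext x
    simp only [Set.mem_ofPred_eq, Sum.forall, Sum.elim_inl, Sum.elim_inr, Pi.neg_apply,
      LinearMap.neg_apply, neg_le_neg_iff, le_antisymm_iff, forall_and]
  have := finrank_add_two_le_card hQ' hray hQ2 hφ hφQ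
  simp only [Fintype.card_sum, Fintype.card_fin] at this
  omega

/-- Every facet of a polyhedron is defined by one of the inequalities that describe it. -/
theorem IsFacet.exists_eq [FiniteDimensional ℝ E] {ι κ : Type*} [Finite ι] {Q F : Set E}
    {a : ι → Module.Dual ℝ E} {α : ι → ℝ} {c : κ → Module.Dual ℝ E} {γ : κ → ℝ}
    (hQ : Q = {x | (∀ i, a i x ≤ α i) ∧ ∀ j, c j x = γ j}) (hF : IsFacet Q F) :
    ∃ i, F = {x ∈ Q | a i x = α i} := by
  classical
  obtain ⟨⟨f, hf⟩, ⟨φ, t, hφ, hFφ⟩, hdim⟩ := hF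
  have hFQ : F ⊆ Q := by rw [hFφ]; exact fun x hx => hx.1
  have hFt : ∀ x ∈ F, φ x = t := by rw [hFφ]; exact fun x hx => hx.2
  obtain ⟨z, hzQ, hzF⟩ : ∃ z ∈ Q, z ∉ F := by
    by_contra! hsub
    rw [hFQ.antisymm hsub] at hdim
    omega
  have hzt : φ z < t := lt_of_le_of_ne (hφ z hzQ) fun h => hzF (by rw [hFφ]; exact ⟨hzQ, h⟩)
  -- An inequality tight on `F` but not on all of `Q`. Otherwise some point `x` of `F` has slack in
  -- every inequality that is not an implicit equation, and moving from `x` away from `z` stays in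
  -- `Q` while `φ` exceeds `t`.
  obtain ⟨i, ⟨z', hz'Q, hz'⟩, hi⟩ :
      ∃ i, (∃ z ∈ Q, a i z ≠ α i) ∧ ∀ x ∈ F, a i x = α i := by
    by_contra! hcon
    -- a point of `F` at which every inequality that is not an implicit equation is strict
    obtain ⟨x, hx, hxs⟩ : ∃ x ∈ F, ∀ i, (∃ z ∈ Q, a i z ≠ α i) → a i x ≠ α i := by
      have hFconv : Convex ℝ F := by
        intro u hu v hv r s hr hs hrs
        have hu' := hFQ hu
        have hv' := hFQ hv
        rw [hFφ]
        rw [hQ] at hu' hv' ⊢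
        refine ⟨⟨fun i => ?_, fun j => ?_⟩, ?_⟩
        · simp only [map_add, map_smul, smul_eq_mul]
          have h1 := mul_le_mul_of_nonneg_left (hu'.1 i) hr
          have h2 := mul_le_mul_of_nonneg_left (hv'.1 i) hs
          have h3 : r * α i + s * α i = α i := by rw [← add_mul, hrs, one_mul]
          linarith
        · simp only [map_add, map_smul, smul_eq_mul, hu'.2 j, hv'.2 j]
          rw [← add_mul, hrs, one_mul]
        · simp only [map_add, map_smul, smul_eq_mul, hFt u hu, hFt v hv]
          rw [← add_mul, hrs, one_mul]
      have key : ∀ s : Set ι, s.Finite →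
          ∃ x ∈ F, ∀ i ∈ s, (∃ z ∈ Q, a i z ≠ α i) → a i x ≠ α i := by
        intro s hs
        induction s, hs using Set.Finite.induction_on with
        | empty => exact ⟨f, hf, by simp⟩
        | @insert i s _ _ ih =>
          obtain ⟨x, hx, hxs⟩ := ih
          by_cases hi : ∃ z ∈ Q, a i z ≠ α i
          · obtain ⟨y, hy, hyi⟩ := hcon i hi
            -- A midpoint has slack wherever one of its ends does.
            refine ⟨(1 / 2 : ℝ) • x + (1 / 2 : ℝ) • y,
              hFconv hx hy (by norm_num) (by norm_num) (by norm_num), ?_⟩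
            have hx' := hFQ hx
            have hy' := hFQ hy
            rw [hQ] at hx' hy'
            intro j hj hjz heq
            simp only [map_add, map_smul, smul_eq_mul] at heq
            rcases hj with rfl | hj
            · exact hyi (by linarith [hx'.1 j, hy'.1 j])
            · exact hxs j hj hjz (by linarith [hx'.1 j, hy'.1 j])
          · refine ⟨x, hx, fun j hj hjz => ?_⟩
            rcases hj with rfl | hj
            · exact absurd hjz hi
            · exact hxs j hj hjz
      obtain ⟨x, hx, hxs⟩ := key Set.univ Set.finite_univ
      exact ⟨x, hx, fun i => hxs i trivial⟩
    have hxQ := hFQ hx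
    have hxQ' := hxQ
    have hzQ' := hzQ
    rw [hQ] at hxQ' hzQ'
    obtain ⟨ε, hε, hε0⟩ := ((eventually_add_smul_le (a := a) (α := α) (x := x) (x - z)
      fun i => by
        by_cases hi : ∃ z ∈ Q, a i z ≠ α i
        · exact Or.inl (lt_of_le_of_ne (hxQ'.1 i) (hxs i hi))
        · push Not at hi
          right
          rw [map_sub, hi x hxQ, hi z hzQ]
          simp).and self_mem_nhdsWithin).exists
    have := hφ (x + ε • (x - z)) (by
      rw [hQ]
      refine ⟨hε, fun j => ?_⟩
      simp [hxQ'.2 j, hzQ'.2 j])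
    rw [map_add, map_smul, map_sub, hFt x hx, smul_eq_mul] at this
    have h2 : 0 < ε * (t - φ z) := mul_pos hε0 (by linarith)
    linarith
  refine ⟨i, Set.Subset.antisymm (fun x hx => ⟨hFQ hx, hi x hx⟩) ?_⟩
  -- `F ⊆ G ⊆ Q`, and the direction of `G` is strictly smaller than that of `Q`. Since `F` has
  -- codimension one, `F` and `G` have the same direction.
  set G : Set E := {x ∈ Q | a i x = α i}
  have hFG : F ⊆ G := fun x hx => ⟨hFQ hx, hi x hx⟩
  have hGQ : G ⊆ Q := fun x hx => hx.1
  have hker : ∀ (S : Set E) (ψ : Module.Dual ℝ E) (r : ℝ), (∀ x ∈ S, ψ x = r) →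
      vectorSpan ℝ S ≤ LinearMap.ker ψ := by
    intro S ψ r h
    rw [vectorSpan_def, Submodule.span_le]
    rintro _ ⟨u, hu, v, hv, rfl⟩
    simp [h u hu, h v hv]
  have hlt : vectorSpan ℝ G < vectorSpan ℝ Q := by
    refine lt_of_le_of_ne (vectorSpan_mono ℝ hGQ) fun heq => ?_
    have h1 : z' - f ∈ vectorSpan ℝ G := by
      rw [heq]
      exact vsub_mem_vectorSpan ℝ hz'Q (hFQ hf)
    have h2 := hker G (a i) (α i) (fun x hx => hx.2) h1
    rw [LinearMap.mem_ker, map_sub, hi f hf] at h2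
    exact hz' (by linarith)
  have hrank := Submodule.finrank_lt_finrank_of_lt hlt
  have heq : vectorSpan ℝ F = vectorSpan ℝ G :=
    Submodule.eq_of_le_of_finrank_le (vectorSpan_mono ℝ hFG) (by omega)
  intro g hg
  have h1 : g - f ∈ vectorSpan ℝ F := by
    rw [heq]
    exact vsub_mem_vectorSpan ℝ hg (hFG hf)
  have h2 := hker F φ t hFt h1
  rw [LinearMap.mem_ker, map_sub, hFt f hf] at h2
  rw [hFφ]
  exact ⟨hGQ hg, by linarith⟩

end Polyhedra

/-! ### Linear algebra of the encoding -/

variable {n k : ℕ}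

theorem sub_mem_linSpace (h : Fin n → Fin k → ℝ) (i j : Fin n) : h i - h j ∈ linSpace h :=
  AffineSubspace.vsub_mem_direction (mem_affineSpan ℝ (Set.mem_range_self i))
    (mem_affineSpan ℝ (Set.mem_range_self j))

/-- Differences of encoding vectors telescope into consecutive ones. -/
theorem linSpace_eq_span_steps (h : Fin n → Fin k → ℝ) :
    linSpace h = Submodule.span ℝ (steps h) := by
  apply le_antisymm
  · rw [linSpace, direction_affineSpan, vectorSpan_def, Submodule.span_le]
    have key : ∀ (m : ℕ) (i j : Fin n), (j : ℕ) = i + m →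
        h j - h i ∈ Submodule.span ℝ (steps h) := by
      intro m
      induction m with
      | zero =>
        intro i j hij
        rw [show j = i from Fin.ext (by simpa using hij), sub_self]
        exact zero_mem _
      | succ m ih =>
        intro i j hij
        have hlt : (i : ℕ) + m < n := by have := j.2; omega
        rw [← sub_add_sub_cancel (h j) (h ⟨i + m, hlt⟩) (h i)]
        exact add_mem (Submodule.subset_span ⟨_, _, by simp [hij, add_assoc], rfl⟩)
          (ih i ⟨i + m, hlt⟩ rfl)
    rintro _ ⟨_, ⟨i, rfl⟩, _, ⟨j, rfl⟩, rfl⟩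
    simp only [vsub_eq_sub, SetLike.mem_coe]
    rcases le_total (j : ℕ) i with hji | hij
    · exact key (i - j) j i (by omega)
    · rw [← neg_sub]
      exact neg_mem (key (j - i) i j (by omega))
  · rw [Submodule.span_le]
    rintro _ ⟨i, j, -, rfl⟩
    exact sub_mem_linSpace h j i

/-- A space of dimension `r` contains at most `2 ^ r` differences of `0`-`1` vectors. -/
theorem clog_le_finrank_linSpace {h : Fin n → Fin k → ℝ} (hh : h ∈ encodings n k) :
    Nat.clog 2 n ≤ Module.finrank ℝ (linSpace h) := by
  classical
  let f : Fin k → Module.Dual ℝ (linSpace h) :=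
    fun l => (LinearMap.proj l).comp (linSpace h).subtype
  -- A maximal independent set of coordinate functionals on `L(H)`. If two encoding vectors agree on
  -- these coordinates, their difference is killed by all coordinates.
  obtain ⟨b, hb, hspan, hli⟩ := exists_linearIndependent ℝ (Set.range f)
  have : Fintype b := hli.setFinite.fintype
  have hcard : Fintype.card b ≤ Module.finrank ℝ (linSpace h) :=
    hli.fintype_card_le_finrank.trans_eq Subspace.dual_finrank_eq
  choose l hl using fun x : b => hb x.2
  have hinj : Function.Injective fun (i : Fin n) (x : b) => decide (h i (l x) = 1) := by
    intro i j hij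
    refine hh.2 (sub_eq_zero.1 ?_)
    have hx : ∀ x : b, h i (l x) = h j (l x) := by
      intro x
      have := congrFun hij x
      simp only [decide_eq_decide] at this
      rcases hh.1 i (l x) with hi | hi <;> rcases hh.1 j (l x) with hj | hj <;>
        simp [hi, hj] at this ⊢
    have hle : Submodule.span ℝ b ≤ LinearMap.ker
        (Module.Dual.eval ℝ (linSpace h) ⟨h i - h j, sub_mem_linSpace h i j⟩) := by
      rw [Submodule.span_le]
      intro y hy
      have h1 : y = f (l ⟨y, hy⟩) := (hl ⟨y, hy⟩).symm
      rw [SetLike.mem_coe, LinearMap.mem_ker, h1]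
      simp [f, hx ⟨y, hy⟩]
    rw [hspan] at hle
    ext m
    have := hle (Submodule.subset_span (Set.mem_range_self m))
    simpa [f] using this
  have hn := Fintype.card_le_of_injective _ hinj
  simp only [Fintype.card_fin, Fintype.card_fun, Fintype.card_bool] at hn
  exact (Nat.clog_le_of_le_pow hn).trans hcard

/-- A basis of `L(H)` made of consecutive differences, and its dual basis. -/
theorem exists_dual_steps (h : Fin n → Fin k → ℝ) :
    ∃ (B : Set (Fin k → ℝ)) (d : B → Fin k → ℝ), B ⊆ steps h ∧
      ENat.card B = Module.finrank ℝ (linSpace h) ∧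
      (∀ x, IsSpannedNormal h (d x)) ∧
      ∀ x y : B, d x ⬝ᵥ (y : Fin k → ℝ) = if y = x then 1 else 0 := by
  classical
  obtain ⟨B, hB, hspan, hli⟩ := exists_linearIndependent ℝ (steps h)
  rw [← linSpace_eq_span_steps] at hspan
  have : Fintype B := hli.setFinite.fintype
  have hcard : Fintype.card B = Module.finrank ℝ (linSpace h) := by
    have := finrank_span_eq_card hli
    rw [Subtype.range_coe, hspan] at this
    exact this.symm
  let A : linSpace h →ₗ[ℝ] (B → ℝ) :=
    { toFun := fun v x => (v : Fin k → ℝ) ⬝ᵥ (x : Fin k → ℝ)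
      map_add' := fun v w => by ext; simp [add_dotProduct]
      map_smul' := fun c v => by ext; simp [smul_dotProduct] }
  -- A vector of `L(H)` orthogonal to the basis `B` is orthogonal to itself.
  have hA : Function.Injective A := by
    rw [← LinearMap.ker_eq_bot, LinearMap.ker_eq_bot']
    intro v hv
    have hle : Submodule.span ℝ B ≤ LinearMap.ker (dotProductBilin ℝ ℝ (v : Fin k → ℝ)) := by
      rw [Submodule.span_le]
      intro y hy
      exact congrFun hv ⟨y, hy⟩
    rw [hspan] at hle
    exact Subtype.ext (dotProduct_self_eq_zero.1 (hle v.2))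
  have hsurj := (LinearMap.injective_iff_surjective_of_finrank_eq_finrank
    (by rw [Module.finrank_fintype_fun_eq_card, hcard])).1 hA
  choose d hd using fun x : B => hsurj (Pi.single x 1)
  have hd' : ∀ x y : B, (d x : Fin k → ℝ) ⬝ᵥ (y : Fin k → ℝ) = if y = x then 1 else 0 := by
    intro x y
    have := congrFun (hd x) y
    rwa [Pi.single_apply] at this
  refine ⟨B, fun x => d x, hB, by rw [ENat.card_eq_coe_fintype_card, hcard],
    fun x => ⟨(d x).2, fun h0 => ?_, B \ {(x : Fin k → ℝ)}, Set.sdiff_subset.trans hB, ?_⟩, hd'⟩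
  · have := hd' x x
    simp [h0] at this
  · have hle : Submodule.span ℝ (B \ {(x : Fin k → ℝ)}) ≤
        LinearMap.ker (dotProductBilin ℝ ℝ (d x : Fin k → ℝ)) := by
      rw [Submodule.span_le]
      intro y hy
      have := hd' x ⟨y, hy.1⟩
      rw [if_neg (fun h : (⟨y, hy.1⟩ : B) = x => hy.2 (congrArg Subtype.val h))] at this
      exact this
    ext y
    constructor
    · intro hy
      refine ⟨?_, hle hy⟩
      rw [← hspan]
      exact Submodule.span_mono Set.sdiff_subset hy
    · rintro ⟨hyL, hy⟩
      rw [← hspan, ← Set.insert_sdiff_self_of_mem x.2, Submodule.mem_span_insert] at hyL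
      obtain ⟨a, z, hz, rfl⟩ := hyL
      have h1 : (d x : Fin k → ℝ) ⬝ᵥ z = 0 := hle hz
      rw [dotProduct_add, dotProduct_smul, hd', if_pos rfl, h1] at hy
      have ha : a = 0 := by simpa using hy
      rw [ha, zero_smul, zero_add]
      exact hz

theorem IsSpannedNormal.smul {h : Fin n → Fin k → ℝ} {b : Fin k → ℝ} (hb : IsSpannedNormal h b)
    {c : ℝ} (hc : c ≠ 0) : IsSpannedNormal h (c • b) := by
  obtain ⟨h1, h2, S, hS, hSb⟩ := hb
  refine ⟨Submodule.smul_mem _ _ h1, smul_ne_zero hc h2, S, hS, ?_⟩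
  rw [hSb]
  ext y
  simp [hyperplane, smul_dotProduct, hc]

/-- A hyperplane spanned by consecutive differences misses one of them. -/
theorem IsSpannedNormal.exists_step {h : Fin n → Fin k → ℝ} {b : Fin k → ℝ}
    (hb : IsSpannedNormal h b) : ∃ s ∈ steps h, b ⬝ᵥ s ≠ 0 := by
  by_contra! hcon
  have hle : Submodule.span ℝ (steps h) ≤ LinearMap.ker (dotProductBilin ℝ ℝ b) := by
    rw [Submodule.span_le]
    exact hcon
  rw [← linSpace_eq_span_steps] at hle
  exact hb.2.1 (dotProduct_self_eq_zero.1 (hle hb.1))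

/-- Families of sets indexed by signed elements of `L(H)` that can be told apart by a witness are
at least as numerous as the signed elements of a basis of `L(H)`. -/
theorem two_mul_finrank_le_encard {α : Type*} (h : Fin n → Fin k → ℝ) {C : Set (Set α)}
    (S : (Fin k → ℝ) → Set α) (hS : ∀ b, IsSpannedNormal h b → S b ∈ C)
    (hsep : ∀ s ∈ steps h, ∃ p : Bool → α, ∀ b,
      (p true ∈ S b ↔ b ⬝ᵥ s ≤ 0) ∧ (p false ∈ S b ↔ 0 ≤ b ⬝ᵥ s)) :
    ((2 * Module.finrank ℝ (linSpace h) : ℕ) : ℕ∞) ≤ C.encard := by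
  classical
  obtain ⟨B, d, hB, hcard, hd, hdd⟩ := exists_dual_steps h
  let g : B × Bool → Set α := fun x => S ((if x.2 then (1 : ℝ) else -1) • d x.1)
  have hg : Function.Injective g := by
    rintro ⟨x, s⟩ ⟨y, t⟩ hxy
    by_contra hne
    -- The witness for `x` reads off the sign of `b ⬝ᵥ x`, which is `±1` for `b = ±d x` and zero for
    -- `b = ±d y` with `y ≠ x`.
    obtain ⟨p, hp⟩ := hsep x (hB x.2)
    have h1 := hp ((if s then (1 : ℝ) else -1) • d x)
    have h2 := hp ((if t then (1 : ℝ) else -1) • d y)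
    simp only [g] at hxy
    rw [hxy] at h1
    rw [smul_dotProduct, hdd, if_pos rfl] at h1
    rw [smul_dotProduct, hdd] at h2
    by_cases hxy' : x = y
    · subst hxy'
      cases s <;> cases t <;> simp_all <;> linarith
    · rw [if_neg hxy', smul_zero] at h2
      cases s <;> simp_all <;> linarith
  calc ((2 * Module.finrank ℝ (linSpace h) : ℕ) : ℕ∞) = ENat.card (B × Bool) := by
        rw [ENat.card_prod, hcard, ENat.card_eq_coe_fintype_card (α := Bool), Fintype.card_bool,
          mul_comm]
        push_cast
        rfl
    _ = (Set.range g).encard := by rw [← Set.image_univ, hg.encard_image, Set.encard_univ]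
    _ ≤ C.encard := by
        refine Set.encard_le_encard ?_
        rintro _ ⟨x, rfl⟩
        exact hS _ ((hd x.1).smul (by split_ifs <;> norm_num))

/-! ### The general inequalities as linear functionals -/

section Gap

variable [NeZero n]

theorem before_succ (h : Fin n → Fin k → ℝ) (i : Fin n) : before h i.succ = h i := by
  unfold before
  congr 1
  ext
  simp

theorem after_castSucc (h : Fin n → Fin k → ℝ) (i : Fin n) : after h i.castSucc = h i := by
  unfold after
  congr 1
  ext
  have : min (i : ℕ) (n - 1) = i := by omega
  simp [this]

theorem before_or_after_eq (h : Fin n → Fin k → ℝ) {i : Fin n} {j : Fin (n + 1)}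
    (hij : j = i.castSucc ∨ j = i.succ) : after h j = h i ∨ before h j = h i := by
  rcases hij with rfl | rfl
  · exact Or.inl (after_castSucc h i)
  · exact Or.inr (before_succ h i)

theorem exists_after_eq (h : Fin n → Fin k → ℝ) (j : Fin (n + 1)) :
    ∃ i : Fin n, after h j = h i ∧ (j = i.castSucc ∨ j = i.succ) := by
  have hn := NeZero.pos n
  refine ⟨Fin.ofNat n (min (j : ℕ) (n - 1)), rfl, ?_⟩
  have hj := j.2
  have : min (j : ℕ) (n - 1) % n = min (j : ℕ) (n - 1) := Nat.mod_eq_of_lt (by omega)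
  simp only [Fin.ext_iff, Fin.val_castSucc, Fin.val_succ, Fin.val_ofNat, this]
  omega

theorem exists_before_eq (h : Fin n → Fin k → ℝ) (j : Fin (n + 1)) :
    ∃ i : Fin n, before h j = h i ∧ (j = i.castSucc ∨ j = i.succ) := by
  have hn := NeZero.pos n
  refine ⟨Fin.ofNat n ((j : ℕ) - 1), rfl, ?_⟩
  have hj := j.2
  have : ((j : ℕ) - 1) % n = (j : ℕ) - 1 := Nat.mod_eq_of_lt (by omega)
  simp only [Fin.ext_iff, Fin.val_castSucc, Fin.val_succ, Fin.val_ofNat, this]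
  omega

theorem after_sub_before (h : Fin n → Fin k → ℝ) (j : Fin (n + 1)) :
    after h j - before h j ∈ steps h ∨ after h j = before h j := by
  have hn := NeZero.pos n
  have hj := j.2
  by_cases h0 : (j : ℕ) = 0
  · right
    simp [after, before, h0]
  by_cases h1 : (j : ℕ) = n
  · right
    unfold after before
    congr 2
    omega
  · left
    refine ⟨_, _, ?_, rfl⟩
    simp only [Fin.val_ofNat]
    rw [Nat.mod_eq_of_lt (by omega), Nat.mod_eq_of_lt (by omega)]
    omega

theorem exists_position_of_mem_steps {h : Fin n → Fin k → ℝ} {s : Fin k → ℝ} (hs : s ∈ steps h) :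
    ∃ j, s = after h j - before h j := by
  obtain ⟨i, i', hi, rfl⟩ := hs
  refine ⟨i.succ, ?_⟩
  rw [before_succ, show i.succ = i'.castSucc from Fin.ext (by simp [hi]), after_castSucc]

/-- The difference of the two sides of the lower general inequality with normal vector `b`. -/
def gap (h : Fin n → Fin k → ℝ) (b : Fin k → ℝ) :
    Module.Dual ℝ ((Fin (n + 1) → ℝ) × (Fin k → ℝ)) where
  toFun x := b ⬝ᵥ x.2 - ∑ j, min (b ⬝ᵥ after h j) (b ⬝ᵥ before h j) * x.1 j
  map_add' x y := by
    simp only [Prod.snd_add, Prod.fst_add, dotProduct_add, Pi.add_apply, mul_add,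
      Finset.sum_add_distrib]
    ring
  map_smul' c x := by
    simp only [Prod.smul_snd, Prod.smul_fst, dotProduct_smul, Pi.smul_apply, smul_eq_mul,
      RingHom.id_apply, mul_sub, Finset.mul_sum]
    congr 1
    exact Finset.sum_congr rfl fun j _ => by ring

theorem gap_apply (h : Fin n → Fin k → ℝ) (b : Fin k → ℝ)
    (x : (Fin (n + 1) → ℝ) × (Fin k → ℝ)) :
    gap h b x = b ⬝ᵥ x.2 - ∑ j, min (b ⬝ᵥ after h j) (b ⬝ᵥ before h j) * x.1 j := rfl

theorem gap_vertex (h : Fin n → Fin k → ℝ) (b : Fin k → ℝ) (j : Fin (n + 1)) (v : Fin k → ℝ) :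
    gap h b (Pi.single j 1, v) = b ⬝ᵥ v - min (b ⬝ᵥ after h j) (b ⬝ᵥ before h j) := by
  simp [gap_apply, Pi.single_apply]

theorem gap_zero_left (h : Fin n → Fin k → ℝ) (b v : Fin k → ℝ) : gap h b (0, v) = b ⬝ᵥ v := by
  simp [gap_apply]

theorem gap_neg (h : Fin n → Fin k → ℝ) (b : Fin k → ℝ)
    (x : (Fin (n + 1) → ℝ) × (Fin k → ℝ)) :
    gap h (-b) x = ∑ j, max (b ⬝ᵥ after h j) (b ⬝ᵥ before h j) * x.1 j - b ⬝ᵥ x.2 := by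
  simp only [gap_apply, neg_dotProduct, min_neg_neg, neg_mul, Finset.sum_neg_distrib]
  ring

theorem gap_smul (h : Fin n → Fin k → ℝ) (b : Fin k → ℝ) {c : ℝ} (hc : 0 ≤ c)
    (x : (Fin (n + 1) → ℝ) × (Fin k → ℝ)) : gap h (c • b) x = c * gap h b x := by
  simp only [gap_apply, smul_dotProduct, smul_eq_mul, ← mul_min_of_nonneg _ _ hc, mul_sub,
    Finset.mul_sum, mul_assoc]

/-- Replacing `b` by `-b` turns the upper inequality into a lower one, so the lower ones alone
suffice. -/
theorem generalInequalities_eq (h : Fin n → Fin k → ℝ) :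
    generalInequalities h = {S | ∃ b, IsSpannedNormal h b ∧ S = {x | 0 ≤ gap h b x}} := by
  have h1 : ∀ b, {x : (Fin (n + 1) → ℝ) × (Fin k → ℝ) |
      ∑ j, min (b ⬝ᵥ after h j) (b ⬝ᵥ before h j) * x.1 j ≤ b ⬝ᵥ x.2} =
      {x | 0 ≤ gap h b x} := fun b => by
    ext x
    simp [gap_apply]
  have h2 : ∀ b, {x : (Fin (n + 1) → ℝ) × (Fin k → ℝ) |
      b ⬝ᵥ x.2 ≤ ∑ j, max (b ⬝ᵥ after h j) (b ⬝ᵥ before h j) * x.1 j} =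
      {x | 0 ≤ gap h (-b) x} := fun b => by
    ext x
    simp [gap_neg]
  ext S
  constructor
  · rintro ⟨b, hb, hS | hS⟩
    · exact ⟨b, hb, hS.trans (h1 b)⟩
    · refine ⟨-b, ?_, hS.trans (h2 b)⟩
      rw [← neg_one_smul ℝ b]
      exact hb.smul (by norm_num)
  · rintro ⟨b, hb, hS⟩
    exact ⟨b, hb, Or.inl (hS.trans (h1 b).symm)⟩

theorem two_mul_finrank_le_generalInequalities (h : Fin n → Fin k → ℝ) :
    ((2 * Module.finrank ℝ (linSpace h) : ℕ) : ℕ∞) ≤ (generalInequalities h).encard := by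
  refine two_mul_finrank_le_encard h (fun b => {x | 0 ≤ gap h b x})
    (fun b hb => by rw [generalInequalities_eq]; exact ⟨b, hb, rfl⟩)
    -- At `λ = 0` the gap is just `b ⬝ᵥ y`; the witnesses need not lie in `Q`.
    fun s _ => ⟨fun t => (0, if t then -s else s), fun b => ⟨?_, ?_⟩⟩
  · simp [gap_zero_left]
  · simp [gap_zero_left]

end Gap

/-! ### Vertices of the embedding polytope and the lower bound on its size -/

theorem vertex_mem_sos2 {i : Fin n} {j : Fin (n + 1)} (hij : j = i.castSucc ∨ j = i.succ) :
    Pi.single j 1 ∈ sos2 n i := by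
  refine ⟨single_mem_stdSimplex ℝ j, fun j' h1 h2 => ?_⟩
  rw [Pi.single_eq_of_ne]
  rintro rfl
  tauto

theorem vertex_mem_embeddingHull (h : Fin n → Fin k → ℝ) {i : Fin n} {j : Fin (n + 1)}
    (hij : j = i.castSucc ∨ j = i.succ) :
    ((Pi.single j 1, h i) : (Fin (n + 1) → ℝ) × (Fin k → ℝ)) ∈ embeddingHull (sos2 n) h :=
  subset_convexHull ℝ _ (Set.mem_iUnion.2 ⟨i, vertex_mem_sos2 hij, rfl⟩)

theorem eq_castSucc_or_succ {i : Fin n} {x : Fin (n + 1) → ℝ} (hx : x ∈ sos2 n i)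
    {j : Fin (n + 1)} (hj : x j ≠ 0) : j = i.castSucc ∨ j = i.succ := by
  by_contra! hne
  exact hj (le_antisymm (hx.2 j hne.1 hne.2) (hx.1.1 j))

theorem snd_smul_sum {i : Fin n} {x : Fin (n + 1) → ℝ} (hx : x ∈ sos2 n i) (v : Fin k → ℝ) :
    ((x, v) : (Fin (n + 1) → ℝ) × (Fin k → ℝ)) = ∑ j, x j • (Pi.single j 1, v) := by
  ext m
  · simp [Prod.fst_sum, Finset.sum_apply, Pi.single_apply]
  · simp [Prod.snd_sum, Finset.sum_apply, ← Finset.sum_mul, hx.1.2]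

/-- A linear inequality is valid for the embedding formulation if it is valid at the vertices. -/
theorem forall_mem_embeddingHull {h : Fin n → Fin k → ℝ}
    (φ : Module.Dual ℝ ((Fin (n + 1) → ℝ) × (Fin k → ℝ))) (t : ℝ)
    (hφ : ∀ (i : Fin n) (j : Fin (n + 1)), (j = i.castSucc ∨ j = i.succ) →
      t ≤ φ (Pi.single j 1, h i)) :
    ∀ x ∈ embeddingHull (sos2 n) h, t ≤ φ x := by
  intro x hx
  refine convexHull_min (t := {x | t ≤ φ x}) ?_ (convex_halfSpace_ge φ.isLinear t) hx
  refine Set.iUnion_subset fun i => ?_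
  rintro ⟨x, _⟩ ⟨hx : x ∈ sos2 n i, rfl⟩
  -- A point of `P^i × {h^i}` is the convex combination of the `(e_j, h^i)` with weights `x j`.
  rw [Set.mem_ofPred_eq, snd_smul_sum hx, map_sum]
  calc t = ∑ j, x j * t := by rw [← Finset.sum_mul, hx.1.2, one_mul]
    _ ≤ _ := Finset.sum_le_sum fun j _ => by
      rw [map_smul, smul_eq_mul]
      by_cases hj : x j = 0
      · simp [hj]
      · exact mul_le_mul_of_nonneg_left (hφ i j (eq_castSucc_or_succ hx hj)) (hx.1.1 j)

theorem coord_nonneg (h : Fin n → Fin k → ℝ) (j : Fin (n + 1)) :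
    ∀ x ∈ embeddingHull (sos2 n) h, 0 ≤ x.1 j :=
  forall_mem_embeddingHull ((LinearMap.proj j).comp (LinearMap.fst ℝ _ _)) 0 fun i j' _ => by
    by_cases hj : j = j' <;> simp [hj]

/-- The sum of the simplex variables. -/
def coordSum (n k : ℕ) : Module.Dual ℝ ((Fin (n + 1) → ℝ) × (Fin k → ℝ)) :=
  (∑ j, LinearMap.proj j).comp (LinearMap.fst ℝ _ _)

theorem coordSum_apply (x : (Fin (n + 1) → ℝ) × (Fin k → ℝ)) : coordSum n k x = ∑ j, x.1 j := by
  simp [coordSum]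

theorem coordSum_eq_one (h : Fin n → Fin k → ℝ) :
    ∀ x ∈ embeddingHull (sos2 n) h, coordSum n k x = 1 := by
  intro x hx
  have h1 := forall_mem_embeddingHull (h := h) (coordSum n k) 1
    (fun i j _ => by simp [coordSum_apply]) x hx
  have h2 := forall_mem_embeddingHull (h := h) (-coordSum n k) (-1)
    (fun i j _ => by simp [coordSum_apply]) x hx
  rw [LinearMap.neg_apply] at h2
  linarith

theorem snd_mem_Icc {h : Fin n → Fin k → ℝ} (hh : h ∈ encodings n k) (l : Fin k) :
    ∀ x ∈ embeddingHull (sos2 n) h, 0 ≤ x.2 l ∧ x.2 l ≤ 1 := by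
  let φ : Module.Dual ℝ ((Fin (n + 1) → ℝ) × (Fin k → ℝ)) :=
    (LinearMap.proj l).comp (LinearMap.snd ℝ _ _)
  intro x hx
  have h1 := forall_mem_embeddingHull (h := h) φ 0
    (fun i j _ => by rcases hh.1 i l with e | e <;> simp [φ, e]) x hx
  have h2 := forall_mem_embeddingHull (h := h) (-φ) (-1)
    (fun i j _ => by rcases hh.1 i l with e | e <;> simp [φ, e]) x hx
  simp only [φ, LinearMap.neg_apply, LinearMap.comp_apply, LinearMap.snd_apply,
    LinearMap.proj_apply] at h1 h2
  exact ⟨h1, by linarith⟩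

theorem eq_zero_of_forall_add_mul_mem_Icc {x v : ℝ}
    (h : ∀ t : ℝ, 0 ≤ t → 0 ≤ x + t * v ∧ x + t * v ≤ 1) : v = 0 := by
  have h0 := h 0 le_rfl
  rcases lt_trichotomy v 0 with hv | hv | hv
  -- This `t` moves the coordinate by `2`, out of the unit interval.
  · have := (h (-2 / v) (by exact div_nonneg_of_nonpos (by norm_num) hv.le)).1
    rw [div_mul_cancel₀ _ hv.ne] at this
    linarith
  · exact hv
  · have := (h (2 / v) (by positivity)).2
    rw [div_mul_cancel₀ _ hv.ne'] at this
    linarith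

theorem size_embeddingHull_ge [NeZero n] {h : Fin n → Fin k → ℝ} (hh : h ∈ encodings n k) :
    ((n + 3 + k : ℕ) : ℕ∞) ≤ size (embeddingHull (sos2 n) h) := by
  have hn := NeZero.pos n
  have hfin : Module.finrank ℝ ((Fin (n + 1) → ℝ) × (Fin k → ℝ)) + 2 = n + 3 + k := by
    rw [Module.finrank_prod]
    simp only [Module.finrank_fintype_fun_eq_card, Fintype.card_fin]
    omega
  rw [← hfin]
  refine finrank_add_two_le_size ?_ ?_ (φ := coordSum n k) ?_ (coordSum_eq_one h)
  · intro x hx v hv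
    have hle : ∀ y ∈ embeddingHull (sos2 n) h, ∀ j, y.1 j ≤ 1 := fun y hy j => by
      have := coordSum_eq_one h y hy
      rw [coordSum_apply] at this
      rw [← this]
      exact Finset.single_le_sum (f := y.1) (fun j _ => coord_nonneg h j y hy)
        (Finset.mem_univ j)
    ext m
    · exact eq_zero_of_forall_add_mul_mem_Icc fun t ht =>
        ⟨coord_nonneg h m _ (hv t ht), hle _ (hv t ht) m⟩
    · exact eq_zero_of_forall_add_mul_mem_Icc fun t ht => snd_mem_Icc hh m _ (hv t ht)
  · refine ⟨_, vertex_mem_embeddingHull h (i := ⟨0, hn⟩) (Or.inl rfl),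
      _, vertex_mem_embeddingHull h (i := ⟨0, hn⟩) (Or.inr rfl), fun heq => ?_⟩
    have := congrFun (congrArg Prod.fst heq) (Fin.castSucc ⟨0, hn⟩)
    simp at this
  · intro h0
    have := coordSum_apply (n := n) (k := k) (Pi.single 0 1, 0)
    rw [h0] at this
    simp at this

/-! ### General inequalities define non-bound facets -/

section Facets

variable [NeZero n]

theorem gap_nonneg (h : Fin n → Fin k → ℝ) (b : Fin k → ℝ) :
    ∀ x ∈ embeddingHull (sos2 n) h, 0 ≤ gap h b x :=
  forall_mem_embeddingHull (gap h b) 0 fun i j hij => by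
    rw [gap_vertex, sub_nonneg]
    rcases before_or_after_eq h hij with e | e <;> simp [e]

theorem after_vertex_mem (h : Fin n → Fin k → ℝ) (j : Fin (n + 1)) :
    ((Pi.single j 1, after h j) : (Fin (n + 1) → ℝ) × (Fin k → ℝ)) ∈
      embeddingHull (sos2 n) h := by
  obtain ⟨i, hi, hij⟩ := exists_after_eq h j
  rw [hi]
  exact vertex_mem_embeddingHull h hij

theorem before_vertex_mem (h : Fin n → Fin k → ℝ) (j : Fin (n + 1)) :
    ((Pi.single j 1, before h j) : (Fin (n + 1) → ℝ) × (Fin k → ℝ)) ∈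
      embeddingHull (sos2 n) h := by
  obtain ⟨i, hi, hij⟩ := exists_before_eq h j
  rw [hi]
  exact vertex_mem_embeddingHull h hij

/-- The face of the embedding formulation defined by the lower general inequality with normal
vector `b`. -/
def gapFace (h : Fin n → Fin k → ℝ) (b : Fin k → ℝ) :
    Set ((Fin (n + 1) → ℝ) × (Fin k → ℝ)) :=
  {x ∈ embeddingHull (sos2 n) h | gap h b x = 0}

theorem after_mem_gapFace (h : Fin n → Fin k → ℝ) (b : Fin k → ℝ) (j : Fin (n + 1)) :
    ((Pi.single j 1, after h j) : (Fin (n + 1) → ℝ) × (Fin k → ℝ)) ∈ gapFace h b ↔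
      b ⬝ᵥ (after h j - before h j) ≤ 0 := by
  simp only [gapFace, Set.mem_ofPred_eq, after_vertex_mem, true_and, gap_vertex, dotProduct_sub,
    sub_eq_zero, sub_nonpos]
  rw [eq_comm, min_eq_left_iff]

theorem before_mem_gapFace (h : Fin n → Fin k → ℝ) (b : Fin k → ℝ) (j : Fin (n + 1)) :
    ((Pi.single j 1, before h j) : (Fin (n + 1) → ℝ) × (Fin k → ℝ)) ∈ gapFace h b ↔
      0 ≤ b ⬝ᵥ (after h j - before h j) := by
  simp only [gapFace, Set.mem_ofPred_eq, before_vertex_mem, true_and, gap_vertex, dotProduct_sub,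
    sub_eq_zero, sub_nonneg]
  rw [eq_comm, min_eq_right_iff]

theorem exists_mem_gapFace (h : Fin n → Fin k → ℝ) (b : Fin k → ℝ) (j : Fin (n + 1)) :
    ∃ v, ((Pi.single j 1, v) : (Fin (n + 1) → ℝ) × (Fin k → ℝ)) ∈ gapFace h b ∧
      (v = after h j ∨ v = before h j) := by
  rcases le_total (b ⬝ᵥ (after h j - before h j)) 0 with h0 | h0
  · exact ⟨_, (after_mem_gapFace h b j).2 h0, Or.inl rfl⟩
  · exact ⟨_, (before_mem_gapFace h b j).2 h0, Or.inr rfl⟩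

theorem vectorSpan_le_of_forall {E : Type*} [AddCommGroup E] [Module ℝ E] {S : Set E}
    {M : Submodule ℝ E} (f : E) (hS : ∀ x ∈ S, x - f ∈ M) : vectorSpan ℝ S ≤ M := by
  rw [vectorSpan_def, Submodule.span_le]
  rintro _ ⟨x, hx, y, hy, rfl⟩
  have := sub_mem (hS x hx) (hS y hy)
  rwa [sub_sub_sub_cancel_right] at this

/-- The direction of `Q` is that of the face plus the single vector `(0, s)`, where `s` is a step
off the hyperplane. A step in the hyperplane joins two vertices of the face with equal `λ`, so the
face contains all directions `(0, c)` with `c ∈ M(b)`. As the face also has a vertex over every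
`e_j`, these and `(0, s)` generate everything. -/
theorem isFacet_gapFace {h : Fin n → Fin k → ℝ} {b : Fin k → ℝ} (hb : IsSpannedNormal h b) :
    IsFacet (embeddingHull (sos2 n) h) (gapFace h b) := by
  obtain ⟨f, hf, hf'⟩ := exists_mem_gapFace h b 0
  refine ⟨⟨_, hf⟩, ⟨-gap h b, 0, fun x hx => ?_, ?_⟩, ?_⟩
  · rw [LinearMap.neg_apply]
    linarith [gap_nonneg h b x hx]
  · ext x
    simp [gapFace]
  obtain ⟨s, hs, hbs⟩ := hb.exists_step
  obtain ⟨j₀, hj₀⟩ := exists_position_of_mem_steps hs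
  set M := vectorSpan ℝ (gapFace h b)
  set w : (Fin (n + 1) → ℝ) × (Fin k → ℝ) := (0, s)
  have hMker : M ≤ LinearMap.ker (gap h b) :=
    vectorSpan_le_of_forall (Pi.single 0 1, f) fun x hx => by
      rw [LinearMap.mem_ker, map_sub, hx.2, hf.2, sub_zero]
  have hw : w ∉ M := fun hw => hbs (by
    have := hMker hw
    rwa [LinearMap.mem_ker, gap_zero_left] at this)
  have hwQ : w ∈ vectorSpan ℝ (embeddingHull (sos2 n) h) := by
    have := vsub_mem_vectorSpan ℝ (after_vertex_mem h j₀) (before_vertex_mem h j₀)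
    rw [vsub_eq_sub, Prod.mk_sub_mk, sub_self, ← hj₀] at this
    exact this
  -- differences in the second component
  have hL : ∀ c ∈ linSpace h, ((0, c) : (Fin (n + 1) → ℝ) × (Fin k → ℝ)) ∈
      M ⊔ Submodule.span ℝ {w} := by
    obtain ⟨-, -, S, hS, hSb⟩ := id hb
    have hspan : Submodule.span ℝ S ≤ M.comap (LinearMap.inr ℝ (Fin (n + 1) → ℝ) _) := by
      rw [Submodule.span_le]
      intro c hc
      have hc0 : b ⬝ᵥ c = 0 := by
        have : c ∈ hyperplane h b := by rw [← hSb]; exact Submodule.subset_span hc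
        exact this.2
      obtain ⟨j, hj⟩ := exists_position_of_mem_steps (hS hc)
      rw [hj] at hc0
      have := vsub_mem_vectorSpan ℝ ((after_mem_gapFace h b j).2 hc0.le)
        ((before_mem_gapFace h b j).2 hc0.ge)
      rw [vsub_eq_sub, Prod.mk_sub_mk, sub_self, ← hj] at this
      exact this
    intro c hc
    have hsL : s ∈ linSpace h := by
      rw [linSpace_eq_span_steps]
      exact Submodule.subset_span hs
    have hc' : c - ((b ⬝ᵥ c) / (b ⬝ᵥ s)) • s ∈ Submodule.span ℝ S := by
      rw [← SetLike.mem_coe, hSb]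
      refine ⟨sub_mem hc (Submodule.smul_mem _ _ hsL), ?_⟩
      rw [dotProduct_sub, dotProduct_smul, smul_eq_mul, div_mul_cancel₀ _ hbs, sub_self]
    have h1 : ((0, c) : (Fin (n + 1) → ℝ) × (Fin k → ℝ)) =
        (0, c - ((b ⬝ᵥ c) / (b ⬝ᵥ s)) • s) + ((b ⬝ᵥ c) / (b ⬝ᵥ s)) • w := by
      simp [w]
    rw [h1]
    exact add_mem (Submodule.mem_sup_left (hspan hc'))
      (Submodule.mem_sup_right (Submodule.smul_mem _ _ (Submodule.mem_span_singleton_self w)))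
  -- This holds for all pairs `i`, `j`, even if `(e_j, h^i)` is not in `Q`.
  have hvert : ∀ (i : Fin n) (j : Fin (n + 1)),
      ((Pi.single j 1, h i) : (Fin (n + 1) → ℝ) × (Fin k → ℝ)) - (Pi.single 0 1, f) ∈
        M ⊔ Submodule.span ℝ {w} := by
    intro i j
    obtain ⟨v, hv, hv'⟩ := exists_mem_gapFace h b j
    obtain ⟨i', hi'⟩ : ∃ i', v = h i' := by
      rcases hv' with rfl | rfl
      · obtain ⟨i', hi', -⟩ := exists_after_eq h j
        exact ⟨i', hi'⟩
      · obtain ⟨i', hi', -⟩ := exists_before_eq h j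
        exact ⟨i', hi'⟩
    rw [← sub_add_sub_cancel _ ((Pi.single j 1, v) : (Fin (n + 1) → ℝ) × (Fin k → ℝ)) _]
    refine add_mem ?_ (Submodule.mem_sup_left (vsub_mem_vectorSpan ℝ hv hf))
    rw [Prod.mk_sub_mk, sub_self, hi']
    exact hL _ (sub_mem_linSpace h i i')
  have hQM : vectorSpan ℝ (embeddingHull (sos2 n) h) = M ⊔ Submodule.span ℝ {w} := by
    apply le_antisymm
    · rw [embeddingHull, ← direction_affineSpan, affineSpan_convexHull, direction_affineSpan]
      refine vectorSpan_le_of_forall (Pi.single 0 1, f) fun x hx => ?_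
      obtain ⟨i, hi⟩ := Set.mem_iUnion.1 hx
      obtain ⟨x, v⟩ := x
      obtain ⟨hxi : x ∈ sos2 n i, rfl : v = h i⟩ := hi
      have h1 : ((x, h i) : (Fin (n + 1) → ℝ) × (Fin k → ℝ)) - (Pi.single 0 1, f) =
          ∑ j, x j • ((Pi.single j 1, h i) - (Pi.single 0 1, f)) := by
        simp only [smul_sub, Finset.sum_sub_distrib, ← Finset.sum_smul, hxi.1.2, one_smul]
        rw [← snd_smul_sum hxi]
      rw [h1]
      exact Submodule.sum_mem _ fun j _ => Submodule.smul_mem _ _ (hvert i j)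
    · refine sup_le (vectorSpan_mono ℝ fun x hx => hx.1) ?_
      rw [Submodule.span_singleton_le_iff_mem]
      exact hwQ
  rw [hQM, Submodule.finrank_sup_span_singleton hw]

/-- A bound on `λ` cannot separate two vertices over the same `e_j`, but the face contains exactly
one of them where `b` is nonzero on the step. -/
theorem not_isBoundFace_gapFace {h : Fin n → Fin k → ℝ} {b : Fin k → ℝ}
    (hb : IsSpannedNormal h b) : ¬ IsBoundFace (embeddingHull (sos2 n) h) (gapFace h b) := by
  rintro ⟨j, t, -, hF⟩
  obtain ⟨s, hs, hbs⟩ := hb.exists_step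
  obtain ⟨j₀, rfl⟩ := exists_position_of_mem_steps hs
  have h1 := after_mem_gapFace h b j₀
  have h2 := before_mem_gapFace h b j₀
  simp only [hF, Set.mem_ofPred_eq, after_vertex_mem, before_vertex_mem, true_and] at h1 h2
  have h3 := h1.symm.trans h2
  rcases hbs.lt_or_gt with h0 | h0
  · exact h0.not_ge (h3.1 h0.le)
  · exact h0.not_ge (h3.2 h0.le)

theorem two_mul_finrank_le_generalFacets (h : Fin n → Fin k → ℝ) :
    ((2 * Module.finrank ℝ (linSpace h) : ℕ) : ℕ∞) ≤ (generalFacets h).encard := by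
  refine two_mul_finrank_le_encard h (gapFace h)
    (fun b hb => ⟨isFacet_gapFace hb, not_isBoundFace_gapFace hb⟩) fun s hs => ?_
  obtain ⟨j, rfl⟩ := exists_position_of_mem_steps hs
  exact ⟨fun t => (Pi.single j 1, if t then after h j else before h j),
    fun b => ⟨after_mem_gapFace h b j, before_mem_gapFace h b j⟩⟩

end Facets

/-! ### Gray codes -/

/-- Consecutive vectors of the encoding differ in exactly one component. -/
def IsGray (h : Fin n → Fin k → ℝ) : Prop :=
  ∀ s ∈ steps h, ∃ (l : Fin k) (c : ℝ), s = Pi.single l c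

/-- The binary reflected Gray code. -/
theorem exists_gray_sequence (k : ℕ) : ∃ g : ℕ → Fin k → ℝ, (∀ i l, g i l = 0 ∨ g i l = 1) ∧
    Set.InjOn g (Set.Iio (2 ^ k)) ∧
    ∀ i, i + 1 < 2 ^ k → ∃ (l : Fin k) (c : ℝ), g (i + 1) - g i = Pi.single l c := by
  induction k with
  | zero =>
    refine ⟨fun _ => ![], fun i l => l.elim0, ?_, fun i hi => ?_⟩
    · intro i hi j hj _
      simp only [pow_zero, Set.mem_Iio] at hi hj
      omega
    · simp at hi
  | succ k ih =>
    obtain ⟨g, h01, hinj, hstep⟩ := ih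
    have hpow : 2 ^ (k + 1) = 2 * 2 ^ k := by ring
    refine ⟨fun i => if i < 2 ^ k then Fin.cons 0 (g i) else Fin.cons 1 (g (2 ^ (k + 1) - 1 - i)),
      ?_, ?_, ?_⟩
    · intro i l
      dsimp only
      split_ifs
      · refine Fin.cases ?_ (fun l => ?_) l <;> simp [h01]
      · refine Fin.cases ?_ (fun l => ?_) l <;> simp [h01]
    · intro i hi j hj hij
      simp only [Set.mem_Iio] at hi hj
      simp only at hij
      split_ifs at hij with h1 h2 h2 <;> rw [Fin.cons_inj] at hij
      · exact hinj h1 h2 hij.2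
      · norm_num at hij
      · norm_num at hij
      · have := hinj (Set.mem_Iio.2 (by omega)) (Set.mem_Iio.2 (by omega)) hij.2
        omega
    · intro i hi
      have hcons : ∀ (a : ℝ) (u v : Fin k → ℝ),
          (Fin.cons a u : Fin (k + 1) → ℝ) - Fin.cons a v = Fin.cons 0 (u - v) := by
        intro a u v
        ext l
        refine Fin.cases ?_ (fun l => ?_) l <;> simp
      have hsingle : ∀ (l : Fin k) (c : ℝ),
          (Fin.cons 0 (Pi.single l c) : Fin (k + 1) → ℝ) = Pi.single l.succ c := by
        intro l c
        ext m
        refine Fin.cases ?_ (fun m => ?_) m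
        · simp [Fin.ext_iff]
        · simp [Pi.single_apply]
      simp only
      by_cases h1 : i + 1 < 2 ^ k
      · obtain ⟨l, c, hlc⟩ := hstep i h1
        rw [if_pos h1, if_pos (by omega)]
        exact ⟨l.succ, c, by rw [hcons, hlc, hsingle]⟩
      · by_cases h2 : i < 2 ^ k
        · rw [if_neg h1, if_pos h2, show 2 ^ (k + 1) - 1 - (i + 1) = i by omega]
          refine ⟨0, 1, ?_⟩
          ext l
          refine Fin.cases ?_ (fun l => ?_) l <;> simp
        · obtain ⟨l, c, hlc⟩ := hstep (2 ^ (k + 1) - 1 - (i + 1)) (by omega)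
          rw [show 2 ^ (k + 1) - 1 - (i + 1) + 1 = 2 ^ (k + 1) - 1 - i by omega] at hlc
          rw [if_neg h1, if_neg h2]
          -- The second half runs backwards, which reverses the step.
          refine ⟨l.succ, -c, ?_⟩
          rw [hcons, ← neg_sub, hlc, ← hsingle]
          congr 1
          ext m
          by_cases hm : m = l <;> simp [hm]

theorem exists_gray_encoding (n : ℕ) :
    ∃ h : Fin n → Fin (Nat.clog 2 n) → ℝ, h ∈ encodings n (Nat.clog 2 n) ∧ IsGray h := by
  obtain ⟨g, h01, hinj, hstep⟩ := exists_gray_sequence (Nat.clog 2 n)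
  have hn : n ≤ 2 ^ Nat.clog 2 n := Nat.le_pow_clog (by norm_num) n
  refine ⟨fun i => g i, ⟨fun i => h01 i, fun i j hij => Fin.ext ?_⟩, ?_⟩
  · exact hinj (i.2.trans_le hn) (j.2.trans_le hn) hij
  · rintro _ ⟨i, j, hij, rfl⟩
    have := hstep i (by have := j.2; omega)
    rwa [← hij] at this

/-- At the minimal length, the lower bound on the dimension equals the dimension of the whole space.
-/
theorem linSpace_eq_top {h : Fin n → Fin (Nat.clog 2 n) → ℝ}
    (hh : h ∈ encodings n (Nat.clog 2 n)) : linSpace h = ⊤ := by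
  refine Submodule.eq_top_of_finrank_eq (le_antisymm (Submodule.finrank_le _) ?_)
  rw [Module.finrank_fintype_fun_eq_card, Fintype.card_fin]
  exact clog_le_finrank_linSpace hh

/-- Unit vectors and their negatives. -/
def signedUnit (x : Fin k × Bool) : Fin k → ℝ :=
  Pi.single x.1 (if x.2 then 1 else -1)

theorem IsSpannedNormal.exists_eq_smul_signedUnit {h : Fin n → Fin k → ℝ} (hL : linSpace h = ⊤)
    (hG : IsGray h) {b : Fin k → ℝ} (hb : IsSpannedNormal h b) :
    ∃ (x : Fin k × Bool) (c : ℝ), 0 < c ∧ b = c • signedUnit x := by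
  obtain ⟨-, hb0, S, hS, hSb⟩ := hb
  obtain ⟨l, hl⟩ := Function.ne_iff.1 hb0
  rw [Pi.zero_apply] at hl
  -- As `b l ≠ 0`, no nonzero multiple of `e_l` lies in `M(b)`, so the steps spanning it all vanish
  -- at `l`.
  have hspan : Submodule.span ℝ S ≤ LinearMap.ker (LinearMap.proj l : (Fin k → ℝ) →ₗ[ℝ] ℝ) := by
    rw [Submodule.span_le]
    intro s hs
    obtain ⟨m, c, rfl⟩ := hG s (hS hs)
    have hbs : b ⬝ᵥ Pi.single m c = 0 := by
      have : Pi.single m c ∈ hyperplane h b := by rw [← hSb]; exact Submodule.subset_span hs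
      exact this.2
    rw [dotProduct_single] at hbs
    by_cases hlm : l = m
    · subst hlm
      have : c = 0 := by simpa [hl] using hbs
      simp [this]
    · simp [hlm]
  have hb' : b = Pi.single l (b l) := by
    ext m
    by_cases hlm : m = l
    · subst hlm
      simp
    · rw [Pi.single_eq_of_ne hlm]
      -- This vector is orthogonal to `b`, so its `l`-th entry `b m` must vanish.
      have hv : Pi.single l (b m) - Pi.single m (b l) ∈ Submodule.span ℝ S := by
        rw [← SetLike.mem_coe, hSb]
        refine ⟨by rw [hL]; trivial, ?_⟩
        rw [dotProduct_sub, dotProduct_single, dotProduct_single]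
        ring
      have := hspan hv
      simpa [Pi.single_apply, Ne.symm hlm] using this
  rcases hl.lt_or_gt with h0 | h0
  · refine ⟨(l, false), -b l, by linarith, ?_⟩
    rw [hb']
    ext m
    simp [signedUnit, Pi.single_apply]
  · refine ⟨(l, true), b l, h0, ?_⟩
    rw [hb']
    ext m
    simp [signedUnit, Pi.single_apply]

theorem encard_range_le {α : Type*} (f : Fin k × Bool → α) :
    (Set.range f).encard ≤ ((2 * k : ℕ) : ℕ∞) := by
  rw [← Set.image_univ]
  refine (Set.encard_image_le f Set.univ).trans ?_
  rw [Set.encard_univ, ENat.card_eq_coe_fintype_card, Fintype.card_prod, Fintype.card_fin,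
    Fintype.card_bool, mul_comm]

/-! ### Upper bounds from Gray encodings -/

variable [NeZero n]

theorem encard_generalInequalities_le {h : Fin n → Fin k → ℝ} (hL : linSpace h = ⊤)
    (hG : IsGray h) : (generalInequalities h).encard ≤ ((2 * k : ℕ) : ℕ∞) := by
  refine (Set.encard_le_encard ?_).trans
    (encard_range_le fun x => {y | 0 ≤ gap h (signedUnit x) y})
  rw [generalInequalities_eq]
  rintro _ ⟨b, hb, rfl⟩
  obtain ⟨x, c, hc, rfl⟩ := hb.exists_eq_smul_signedUnit hL hG
  refine ⟨x, ?_⟩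
  ext y
  simp [gap_smul h _ hc.le, mul_nonneg_iff_of_pos_left hc]

/-- When the ends differ only at `l`, the box between them is a segment: the weights found at `l`
serve all coordinates. -/
theorem mem_segment_of_sub_eq_single {a a' u : Fin k → ℝ} {l : Fin k} {c : ℝ}
    (haa' : a' - a = Pi.single l c) (hu : ∀ m, u m ∈ segment ℝ (a m) (a' m)) :
    u ∈ segment ℝ a a' := by
  obtain ⟨r, s, hr, hs, hrs, hl⟩ := hu l
  refine ⟨r, s, hr, hs, hrs, ?_⟩
  ext m
  by_cases hm : m = l
  · subst hm
    exact hl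
  · have h1 : a' m = a m := by
      have := congrFun haa' m
      rw [Pi.single_eq_of_ne hm, Pi.sub_apply] at this
      linarith
    have h2 := hu m
    rw [h1, segment_same] at h2
    rw [Set.mem_singleton_iff.1 h2, Pi.add_apply, Pi.smul_apply, Pi.smul_apply, h1, ← add_smul,
      hrs, one_smul]

/-- The linear description of the embedding formulation for Gray encodings. -/
theorem embeddingHull_eq_of_isGray {h : Fin n → Fin k → ℝ} (hG : IsGray h) :
    embeddingHull (sos2 n) h = {x | (∀ i : Fin (n + 1) ⊕ (Fin k × Bool),
      (Sum.elim (fun j => -(LinearMap.proj j).comp (LinearMap.fst ℝ (Fin (n + 1) → ℝ) _))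
        (fun y => -gap h (signedUnit y)) i : Module.Dual ℝ _) x ≤ (fun _ => (0 : ℝ)) i) ∧
      ∀ i : Unit, (fun _ => coordSum n k) i x = (fun _ => (1 : ℝ)) i} := by
  ext x
  simp only [Set.mem_ofPred_eq, Sum.forall, Sum.elim_inl, Sum.elim_inr, LinearMap.neg_apply,
    LinearMap.comp_apply, LinearMap.fst_apply, LinearMap.proj_apply, neg_nonpos, forall_const]
  constructor
  · exact fun hx => ⟨⟨fun j => coord_nonneg h j x hx, fun y => gap_nonneg h _ x hx⟩,
      coordSum_eq_one h x hx⟩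
  rintro ⟨⟨hx0, hxg⟩, hx1⟩
  rw [coordSum_apply] at hx1
  have hθ : ∀ l, ∃ r s : ℝ, 0 ≤ r ∧ 0 ≤ s ∧ r + s = 1 ∧
      r * (∑ j, min (after h j l) (before h j l) * x.1 j) +
        s * (∑ j, max (after h j l) (before h j l) * x.1 j) = x.2 l := by
    intro l
    have h1 := hxg (l, true)
    have h2 := hxg (l, false)
    have h3 : (signedUnit (l, false) : Fin k → ℝ) = -signedUnit (l, true) := by
      ext m
      by_cases hm : m = l <;> simp [signedUnit, hm]
    rw [h3, gap_neg] at h2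
    rw [gap_apply] at h1
    simp only [signedUnit, if_true, single_dotProduct, one_mul, sub_nonneg] at h1 h2
    have : x.2 l ∈ segment ℝ (∑ j, min (after h j l) (before h j l) * x.1 j)
        (∑ j, max (after h j l) (before h j l) * x.1 j) := by
      rw [segment_eq_Icc (h1.trans h2)]
      exact ⟨h1, h2⟩
    exact this
  choose r s hr hs hrs hrsx using hθ
  -- The weights that place `x.2 l` between its two bounds, applied at each position `j` separately.
  -- Then `u j` lies in the box between `before h j` and `after h j`, a segment by the Gray
  -- property, and `x` is the convex combination of the `(e_j, u j)`.
  let u : Fin (n + 1) → Fin k → ℝ := fun j l =>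
    r l * min (after h j l) (before h j l) + s l * max (after h j l) (before h j l)
  have hu : ∀ j, u j ∈ segment ℝ (before h j) (after h j) := by
    intro j
    have hul : ∀ l, u j l ∈ segment ℝ (before h j l) (after h j l) := by
      intro l
      rw [segment_eq_uIcc, Set.uIcc, inf_comm, sup_comm, ← segment_eq_Icc inf_le_sup]
      exact ⟨r l, s l, hr l, hs l, hrs l, rfl⟩
    rcases after_sub_before h j with hj | hj
    · obtain ⟨l, c, hlc⟩ := hG _ hj
      exact mem_segment_of_sub_eq_single hlc hul
    · rw [hj, segment_same, Set.mem_singleton_iff]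
      ext l
      have := hul l
      rwa [hj, segment_same, Set.mem_singleton_iff] at this
  have hconv : Convex ℝ (embeddingHull (sos2 n) h) := convex_convexHull ℝ _
  have huQ : ∀ j, ((Pi.single j 1, u j) : (Fin (n + 1) → ℝ) × (Fin k → ℝ)) ∈
      embeddingHull (sos2 n) h := by
    intro j
    obtain ⟨p, q, hp, hq, hpq, hpqu⟩ := hu j
    have := hconv (before_vertex_mem h j) (after_vertex_mem h j) hp hq hpq
    rwa [Prod.smul_mk, Prod.smul_mk, Prod.mk_add_mk, hpqu, ← add_smul, hpq, one_smul] at this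
  have hx : x = ∑ j, x.1 j • ((Pi.single j 1, u j) : (Fin (n + 1) → ℝ) × (Fin k → ℝ)) := by
    ext m
    · simp [Prod.fst_sum, Finset.sum_apply, Pi.single_apply]
    · rw [← hrsx m, Prod.snd_sum, Finset.sum_apply, Finset.mul_sum, Finset.mul_sum,
        ← Finset.sum_add_distrib]
      refine Finset.sum_congr rfl fun j _ => ?_
      simp only [u, Prod.smul_snd, Pi.smul_apply, smul_eq_mul]
      ring
  rw [hx]
  exact hconv.sum_mem (fun j _ => hx0 j) hx1 fun j _ => huQ j

theorem size_embeddingHull_le {h : Fin n → Fin k → ℝ} (hG : IsGray h) :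
    size (embeddingHull (sos2 n) h) ≤ ((n + 3 + 2 * k : ℕ) : ℕ∞) := by
  refine (hasDescription_of_fintype _ _ _ _ (embeddingHull_eq_of_isGray hG)).size_le.trans ?_
  -- `n + 1` bounds, `2k` general inequalities, and one equation counted twice.
  rw [Nat.cast_le]
  simp only [Fintype.card_sum, Fintype.card_fin, Fintype.card_prod, Fintype.card_bool,
    Fintype.card_unit]
  omega

theorem encard_generalFacets_le {h : Fin n → Fin k → ℝ} (hG : IsGray h) :
    (generalFacets h).encard ≤ ((2 * k : ℕ) : ℕ∞) := by
  refine (Set.encard_le_encard ?_).trans (encard_range_le fun x => gapFace h (signedUnit x))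
  rintro F ⟨hF, hFb⟩
  obtain ⟨j | x, hx⟩ := hF.exists_eq (embeddingHull_eq_of_isGray hG)
  · refine absurd ⟨j, 0, Or.inl (coord_nonneg h j), ?_⟩ hFb
    rw [hx]
    ext y
    simp
  · refine ⟨x, ?_⟩
    rw [hx]
    ext y
    simp [gapFace]

end EmbeddingFormulation

open EmbeddingFormulation in
theorem proposition4 (n : ℕ) [NeZero n] :
    (mmcG n = ((2 * Nat.clog 2 n : ℕ) : ℕ∞) ∧
      mmcGFacets n = ((2 * Nat.clog 2 n : ℕ) : ℕ∞)) ∧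
    ((n + 3 + Nat.clog 2 n : ℕ) : ℕ∞) ≤ mmc (sos2 n) ∧
    mmc (sos2 n) ≤ ((n + 3 + 2 * Nat.clog 2 n : ℕ) : ℕ∞) := by
  obtain ⟨h, hh, hG⟩ := exists_gray_encoding n
  have hle : ∀ {k : ℕ} {h : Fin n → Fin k → ℝ}, h ∈ encodings n k →
      ((2 * Nat.clog 2 n : ℕ) : ℕ∞) ≤ ((2 * Module.finrank ℝ (linSpace h) : ℕ) : ℕ∞) :=
    fun hh => Nat.cast_le.2 (Nat.mul_le_mul_left 2 (clog_le_finrank_linSpace hh))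
  refine ⟨⟨le_antisymm ?_ ?_, le_antisymm ?_ ?_⟩, ?_, ?_⟩
  · exact iInf₂_le_of_le _ le_rfl (iInf₂_le_of_le h hh
      (encard_generalInequalities_le (linSpace_eq_top hh) hG))
  · exact le_iInf₂ fun k _ => le_iInf₂ fun h hh =>
      (hle hh).trans (two_mul_finrank_le_generalInequalities h)
  · exact iInf₂_le_of_le _ le_rfl (iInf₂_le_of_le h hh (encard_generalFacets_le hG))
  · exact le_iInf₂ fun k _ => le_iInf₂ fun h hh =>
      (hle hh).trans (two_mul_finrank_le_generalFacets h)
  · exact le_iInf₂ fun k hk => le_iInf₂ fun h hh =>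
      (Nat.cast_le.2 (Nat.add_le_add_left hk _)).trans (size_embeddingHull_ge hh)
  · exact iInf₂_le_of_le _ le_rfl (iInf₂_le_of_le h hh (size_embeddingHull_le hG))
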